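/- Let $K$ be a field, complete with respect to a nontrivial rank-$1$ valuation $\nu : K^\times \twoheadrightarrow \Gamma$; thus $\Gamma \neq 0$ is a totally ordered abelian group that admits an embedding of ordered groups $\sigma : \Gamma \hookrightarrow \mathbb{R}$, which we fix. Let $X$ be a separated $K$-scheme of finite type, let $k \ge 1$ be an integer, and let $\mathbb{R}^{(k)}$ be the group $\mathbb{R}^k$ with the lexicographic order (first coordinate most significant). Let $\rho : \Gamma \hookrightarrow \mathbb{R}^{(k)}$, $\gamma \mapsto (\sigma(\gamma), 0, \dots, 0)$, be the embedding into the first factor. For $X = \operatorname{Spec} A$ affine, the Hahn analytification $X^{\mathfrak H}$ is the set of ring valuations $A \to \mathbb{R}^{(k)} \sqcup \{\infty\}$ that restrict to $\rho \circ \nu$ on $K$. The Huber adic space $X^{\mathrm{ad}}$ is the set of valuations $v : A \to \Upsilon \sqcup \{\infty\}$, with $\Upsilon$ an arbitrary totally ordered abelian group, such that 1. $v|_K$ is $\nu$ followed by an embedding of ordered groups $\Gamma \hookrightarrow \Upsilon$; 2. $v$ is continuous in Huber's sense: for every $f \in A$ there is $c \in K^\times$ with $v(c) \le v(f)$, and for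 every $f \in A$ with $v(f) \neq \infty$ there is $c \in K^\times$ with $v(f) < v(c)$; modulo the equivalence relation generated by identifying $v$ with $j \circ v$ for every embedding of ordered groups $j : \Upsilon \hookrightarrow \Upsilon'$. For general $X$, both $X^{\mathfrak H}$ and $X^{\mathrm{ad}}$ are the unions, glued along inclusions, of the corresponding sets for the affine open subschemes of $X$. Every point of $X^{\mathfrak H}$ is in particular a continuous valuation extending $\nu$, and sending it to its equivalence class defines the natural map $\eta : X^{\mathfrak H} \to X^{\mathrm{ad}}$. **Theorem.** If $k \ge 1 + \dim X$ (Krull dimension), then $\eta : X^{\mathfrak H} \to X^{\mathrm{ad}}$ is surjective. -/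

import Mathlib

open AlgebraicGeometry CategoryTheory

universe u w

/-- The totally ordered abelian group `ℝ^(k)`: the product of `k` copies of `ℝ` with the
lexicographic order, the first factor (index `0`) being the most significant one. -/
abbrev LexReal (k : ℕ) : Type := Lex (Fin k → ℝ)

/-- The embedding of `Γ` into `ℝ^(k)` through the first factor, `γ ↦ (σ γ, 0, …, 0)`, attached to
a homomorphism of ordered groups `σ : Γ → ℝ`. -/
noncomputable def firstFactor {Γ : Type w} [AddCommGroup Γ] [LinearOrder Γ] (k : ℕ) [NeZero k]
    (σ : Γ →+o ℝ) : Γ →+o LexReal k where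
  toFun γ := toLex (Pi.single 0 (σ γ))
  map_zero' := by simp
  map_add' a b := by simp [Pi.single_add]
  monotone' a b h := by
    apply Pi.toLex_monotone
    exact Pi.single_le_single.2 (σ.monotone' h)

theorem lexReal_lt_of_zero_lt {k : ℕ} [NeZero k] {a b : LexReal k}
    (h : ofLex a 0 < ofLex b 0) : a < b :=
  ⟨0, fun j hj => absurd hj (Fin.not_lt_zero j), h⟩

theorem firstFactor_zero {Γ : Type w} [AddCommGroup Γ] [LinearOrder Γ] {k : ℕ} [NeZero k]
    (σ : Γ →+o ℝ) (γ : Γ) : ofLex (firstFactor k σ γ) 0 = σ γ :=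
  Pi.single_eq_same (M := fun _ : Fin k => ℝ) 0 (σ γ)

theorem firstFactor_strictMono {Γ : Type w} [AddCommGroup Γ] [LinearOrder Γ] {k : ℕ} [NeZero k]
    {σ : Γ →+o ℝ} (hσ : StrictMono σ) : StrictMono (firstFactor k σ) := fun a b h =>
  lexReal_lt_of_zero_lt (by rw [firstFactor_zero, firstFactor_zero]; exact hσ h)

theorem firstFactor_cofinal {Γ : Type w} [AddCommGroup Γ] [LinearOrder Γ] [Nontrivial Γ]
    {k : ℕ} [NeZero k] {σ : Γ →+o ℝ} (hσ : StrictMono σ) (r : LexReal k) :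
    ∃ γ : Γ, r < firstFactor k σ γ := by
  obtain ⟨γ, hγ⟩ := exists_ne (0 : Γ)
  have h0 : σ γ ≠ 0 := fun h => hγ (hσ.injective (h.trans (map_zero σ).symm))
  obtain ⟨δ, hδ⟩ : ∃ δ : Γ, 0 < σ δ := by
    rcases lt_or_gt_of_ne h0 with h | h
    · exact ⟨-γ, by rw [map_neg]; linarith⟩
    · exact ⟨γ, h⟩
  obtain ⟨n, hn⟩ := Archimedean.arch (ofLex r 0 + 1) hδ
  refine ⟨n • δ, lexReal_lt_of_zero_lt ?_⟩
  rw [firstFactor_zero, map_nsmul]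
  linarith

section Affine

variable {K A B : Type u} [Field K] [CommRing A] [CommRing B]
variable {Γ : Type w} [AddCommGroup Γ] [LinearOrder Γ] [IsOrderedAddMonoid Γ] {k : ℕ}

/-- `K` is complete for (the uniform structure defined by) the valuation `ν`. -/
def IsCompleteValuedField (ν : AddValuation K (WithTop Γ)) : Prop :=
  @CompleteSpace K (Valued.mk' (AddValuation.toValuation ν)).toUniformSpace

/-- A point of the Hahn analytification of `Spec A`, for a `K`-algebra `φ : K → A`: a ring
valuation `val : A → ℝ^(k) ⊔ {∞}` that restricts to `ρ ∘ ν` on `K`. -/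
structure HahnPoint (ν : AddValuation K (WithTop Γ)) (ρ : Γ →+o LexReal k) (φ : K →+* A) where
  val : AddValuation A (WithTop (LexReal k))
  val_map : ∀ z : K, val (φ z) = (ν z).map ρ

/-- A representative of a point of the adic space of `Spec A`, for a `K`-algebra `φ : K → A`:
a valuation `val` on `A` with values in some totally ordered abelian group `Υ` (which may be taken
in the universe of `A`, since the values of `val` generate a group of at most that size), whose
restriction to `K` is `ν` followed by an embedding `ι : Γ → Υ` of ordered groups, and which is
continuous in Huber's sense. The last condition is `bounded` and `continuous` below:
* `bounded`: each `f` satisfies `|f| ≤ |c|` for some `c ∈ Kˣ`, that is, the point lies in one of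
  the affinoid pieces that exhaust the adic space of `Spec A`;
* `continuous`: no `f` has `0 < |f| < |c|` for all `c ∈ Kˣ`.
(Larger `val` means smaller absolute value.) -/
structure AdicValuation (ν : AddValuation K (WithTop Γ)) (φ : K →+* A) : Type (max (u + 1) w) where
  Υ : Type u
  [instGroup : AddCommGroup Υ]
  [instOrder : LinearOrder Υ]
  [instOrdered : IsOrderedAddMonoid Υ]
  val : AddValuation A (WithTop Υ)
  ι : Γ →+o Υ
  ι_strictMono : StrictMono ι
  val_map : ∀ z : K, val (φ z) = (ν z).map ι
  bounded : ∀ f : A, ∃ c : K, c ≠ 0 ∧ val (φ c) ≤ val f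
  continuous : ∀ f : A, val f ≠ ⊤ → ∃ c : K, c ≠ 0 ∧ val f < val (φ c)

attribute [instance] AdicValuation.instGroup AdicValuation.instOrder AdicValuation.instOrdered

/-- The relation that generates the equivalence of valuations: the value group of `v` embeds into
that of `w`, and the embedding carries `v` to `w`. -/
def AdicValuation.Rel {ν : AddValuation K (WithTop Γ)} {φ : K →+* A}
    (v w : AdicValuation ν φ) : Prop :=
  ∃ j : v.Υ →+o w.Υ, StrictMono j ∧ ∀ a : A, w.val a = (v.val a).map j

/-- The adic space of `Spec A` (as a set): valuations up to the equivalence relation generated by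
`AdicValuation.Rel`. -/
def AffineAdicSpace (ν : AddValuation K (WithTop Γ)) (φ : K →+* A) : Type (max (u + 1) w) :=
  Quot (AdicValuation.Rel (ν := ν) (φ := φ))

variable {ν : AddValuation K (WithTop Γ)} {ρ : Γ →+o LexReal k}

/-- Functoriality of the Hahn analytification in the `K`-algebra. -/
noncomputable def HahnPoint.comap {φ : K →+* A} {ψ : K →+* B} (g : A →+* B) (hg : g.comp φ = ψ)
    (x : HahnPoint ν ρ ψ) : HahnPoint ν ρ φ where
  val := x.val.comap g
  val_map z := by subst hg; exact x.val_map z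

/-- Restriction of a valuation along a morphism of `K`-algebras. -/
def AdicValuation.comap {φ : K →+* A} {ψ : K →+* B} (g : A →+* B) (hg : g.comp φ = ψ)
    (x : AdicValuation ν ψ) : AdicValuation ν φ where
  Υ := x.Υ
  val := x.val.comap g
  ι := x.ι
  ι_strictMono := x.ι_strictMono
  val_map z := by subst hg; exact x.val_map z
  bounded f := by subst hg; exact x.bounded (g f)
  continuous f := by subst hg; exact x.continuous (g f)

/-- Functoriality of the adic space in the `K`-algebra. -/
def AffineAdicSpace.comap {φ : K →+* A} {ψ : K →+* B} (g : A →+* B) (hg : g.comp φ = ψ) :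
    AffineAdicSpace ν ψ → AffineAdicSpace ν φ :=
  Quot.map (AdicValuation.comap g hg) fun _ _ ⟨j, hj, h⟩ => ⟨j, hj, fun a => h (g a)⟩

instance : IsOrderedAddMonoid (ULift.{u} (LexReal k)) where
  add_le_add_left a b h c := add_le_add_left (α := LexReal k) (b := a.down) (c := b.down) h c.down

/-- The identification of `ℝ^(k)` with its copy in the universe `u`. -/
def lexRealULift (k : ℕ) : LexReal k →+o ULift.{u} (LexReal k) where
  toFun := ULift.up
  map_zero' := rfl
  map_add' _ _ := rfl
  monotone' _ _ h := h

theorem lexRealULift_strictMono (k : ℕ) : StrictMono (lexRealULift.{u} k) := fun _ _ h => h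

/-- A point of the Hahn analytification is in particular a valuation on `A` that extends `ν`;
it is continuous if `ρ` embeds `Γ` cofinally into `ℝ^(k)`. -/
noncomputable def HahnPoint.toAdic (hν : ∀ γ : Γ, ∃ z : K, ν z = γ) (hρ : StrictMono ρ)
    (hcof : ∀ r : LexReal k, ∃ γ : Γ, r < ρ γ) {φ : K →+* A} (x : HahnPoint ν ρ φ) :
    AdicValuation ν φ where
  Υ := ULift.{u} (LexReal k)
  val := x.val.map ((lexRealULift.{u} k : LexReal k →+ ULift.{u} (LexReal k)).withTopMap) rfl
    (WithTop.monotone_map_iff.2 (lexRealULift.{u} k).monotone')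
  ι := (lexRealULift.{u} k).comp ρ
  ι_strictMono := (lexRealULift_strictMono.{u} k).comp hρ
  val_map z := by
    change WithTop.map (lexRealULift.{u} k) (x.val (φ z)) = _
    rw [x.val_map, WithTop.map_map]
    rfl
  bounded f := by
    change ∃ c : K, c ≠ 0 ∧ WithTop.map (lexRealULift.{u} k) (x.val (φ c)) ≤
      WithTop.map (lexRealULift.{u} k) (x.val f)
    induction hf : x.val f using WithTop.recTopCoe with
    | top => exact ⟨1, one_ne_zero, le_top⟩
    | coe r =>
      obtain ⟨γ, hγ⟩ := hcof (-r)
      obtain ⟨c, hc⟩ := hν (-γ)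
      refine ⟨c, ?_, ?_⟩
      · rintro rfl
        rw [ν.map_zero] at hc
        exact WithTop.top_ne_coe hc
      · rw [x.val_map, hc]
        simp only [WithTop.map_coe, WithTop.coe_le_coe]
        change ρ (-γ) ≤ r
        rw [map_neg]
        exact (neg_lt.1 hγ).le
  continuous f := by
    change WithTop.map (lexRealULift.{u} k) (x.val f) ≠ ⊤ → ∃ c : K, c ≠ 0 ∧
      WithTop.map (lexRealULift.{u} k) (x.val f) <
        WithTop.map (lexRealULift.{u} k) (x.val (φ c))
    induction hf : x.val f using WithTop.recTopCoe with
    | top => exact fun h => absurd rfl h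
    | coe r =>
      intro _
      obtain ⟨γ, hγ⟩ := hcof r
      obtain ⟨c, hc⟩ := hν γ
      refine ⟨c, ?_, ?_⟩
      · rintro rfl
        rw [ν.map_zero] at hc
        exact WithTop.top_ne_coe hc
      · rw [x.val_map, hc]
        simp only [WithTop.map_coe, WithTop.coe_lt_coe]
        exact hγ

end Affine

section Scheme

variable {K : Type u} [Field K] {Γ : Type w} [AddCommGroup Γ] [LinearOrder Γ]
  [IsOrderedAddMonoid Γ] {k : ℕ}

/-- The structure morphism `K → Γ(X, U)` of the ring of functions on an open subset `U` of a
`K`-scheme `f : X → Spec K`. -/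
noncomputable def structureHom {X : Scheme.{u}} (f : X ⟶ Spec (.of K)) (U : X.Opens) :
    K →+* Γ(X, U) :=
  ((Scheme.ΓSpecIso (.of K)).inv ≫ f.appLE ⊤ U (le_top.trans_eq f.preimage_top.symm)).hom

theorem structureHom_restrict {X : Scheme.{u}} (f : X ⟶ Spec (.of K)) {U V : X.Opens}
    (h : U ≤ V) :
    (X.presheaf.map (homOfLE h).op).hom.comp (structureHom f V) = structureHom f U := by
  rw [structureHom, structureHom, ← CommRingCat.hom_comp, Category.assoc, Scheme.Hom.appLE_map]

/-- Two points on affine open pieces are identified if one is the restriction of the other. -/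
def HahnGlue (ν : AddValuation K (WithTop Γ)) (ρ : Γ →+o LexReal k) {X : Scheme.{u}}
    (f : X ⟶ Spec (.of K)) (p q : Σ U : X.affineOpens, HahnPoint ν ρ (structureHom f U.1)) : Prop :=
  ∃ h : p.1.1 ≤ q.1.1, q.2 = p.2.comap _ (structureHom_restrict f h)

/-- The Hahn analytification `X^H` (as a set) of a `K`-scheme `f : X → Spec K`: the union of the
Hahn analytifications of the affine open subschemes `U` of `X`, where `U^H` is identified with its
image in `V^H` whenever `U ⊆ V`. -/
def HahnAnalytification (ν : AddValuation K (WithTop Γ)) (ρ : Γ →+o LexReal k) {X : Scheme.{u}}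
    (f : X ⟶ Spec (.of K)) : Type u :=
  Quot (HahnGlue ν ρ f)

/-- Two points on affine open pieces are identified if one is the restriction of the other. -/
def AdicGlue (ν : AddValuation K (WithTop Γ)) {X : Scheme.{u}} (f : X ⟶ Spec (.of K))
    (p q : Σ U : X.affineOpens, AffineAdicSpace ν (structureHom f U.1)) : Prop :=
  ∃ h : p.1.1 ≤ q.1.1, q.2 = p.2.comap _ (structureHom_restrict f h)

/-- The Huber adic space `X^ad` (as a set) of a `K`-scheme `f : X → Spec K`: the union of the adic
spaces of the affine open subschemes of `X`. -/
def AdicSpace (ν : AddValuation K (WithTop Γ)) {X : Scheme.{u}} (f : X ⟶ Spec (.of K)) :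
    Type (max (u + 1) w) :=
  Quot (AdicGlue ν f)

/-- The natural map `η : X^H → X^ad`, which sends (on each affine open) a valuation with values
in `ℝ^(k) ⊔ {∞}` to its equivalence class. -/
noncomputable def huberComparison {ν : AddValuation K (WithTop Γ)} {ρ : Γ →+o LexReal k}
    (hν : ∀ γ : Γ, ∃ z : K, ν z = γ) (hρ : StrictMono ρ)
    (hcof : ∀ r : LexReal k, ∃ γ : Γ, r < ρ γ) {X : Scheme.{u}} (f : X ⟶ Spec (.of K)) :
    HahnAnalytification ν ρ f → AdicSpace ν f :=
  Quot.map (fun p => ⟨p.1, Quot.mk _ (p.2.toAdic hν hρ hcof)⟩) fun _ _ ⟨h, e⟩ =>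
    ⟨h, congrArg (fun x => Quot.mk _ (HahnPoint.toAdic hν hρ hcof x)) e⟩

end Scheme

/-! A point of the adic space lives on some affine open, as a valuation `v` on a finitely generated
algebra of dimension at most `d = k - 1`. It extends to the residue field `L` of its support, whose
transcendence degree over `K` is at most `d` by Noether normalisation. Abhyankar's inequality
(`AddValuation.exists_int_relation`) then bounds by `d` the rational rank of the value group of `L`
over `Γ`, and Huber continuity makes `Γ` cofinal in that value group.

What remains is a relative Hahn embedding (`exists_extend_lexReal_succ`). By cofinality `σ` extends
to a monotone map `τ` to `ℝ`. Its kernel `H` meets `Γ` trivially, so `H` has rational rank at most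
`d` and embeds into `ℝ^(d)`. Divisibility of `ℝ^d` extends this embedding to a homomorphism `φ` on
the whole group that vanishes on `Γ`, and `(τ, φ)` is the required embedding. The embedding of `H`
comes from induction on `d`, where the same lemma is applied with `ℤ` in place of `Γ`. -/

/-! ### Embeddings of ordered abelian groups into lexicographic powers of `ℝ`. -/

section OrderedGroups

variable {G : Type*} [AddCommGroup G] [LinearOrder G]

/-- `t` is the ratio of `g` to `u`: it makes the same cut in the rational numbers. -/
def IsSlope (u g : G) (t : ℝ) : Prop :=
  ∀ (m : ℤ) (n : ℕ), 0 < n →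
    (m • u ≤ n • g → (m : ℝ) ≤ n * t) ∧ (n • g ≤ m • u → (n : ℝ) * t ≤ m)

theorem OrderAddMonoidHom.isSlope {u : G} (τ : G →+o ℝ) (hu : 0 < τ u) (g : G) :
    IsSlope u g (τ g / τ u) := by
  intro m n _
  refine ⟨fun h => ?_, fun h => ?_⟩
  · have := OrderHomClass.mono τ h
    simp only [map_zsmul, map_nsmul, zsmul_eq_mul, nsmul_eq_mul] at this
    rw [← mul_div_assoc, le_div_iff₀ hu]
    exact this
  · have := OrderHomClass.mono τ h
    simp only [map_zsmul, map_nsmul, zsmul_eq_mul, nsmul_eq_mul] at this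
    rw [← mul_div_assoc, div_le_iff₀ hu]
    exact this

variable [IsOrderedAddMonoid G] {u : G}

theorem exists_zsmul_near (hu : 0 < u) (hcof : ∀ g : G, ∃ n : ℕ, g ≤ n • u) (g : G) :
    ∃ a : ℤ, a • u ≤ g ∧ g < (a + 1) • u := by
  obtain ⟨N, hN⟩ := hcof g
  obtain ⟨M, hM⟩ := hcof (-g)
  obtain ⟨a, ha, hmax⟩ := Int.exists_greatest_of_bdd (P := fun a : ℤ => a • u ≤ g)
    ⟨N, fun z hz => (zsmul_le_zsmul_iff_left hu).1 (hz.trans (by simpa using hN))⟩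
    ⟨-M, by rw [neg_zsmul, natCast_zsmul]; exact neg_le.1 hM⟩
  refine ⟨a, ha, lt_of_not_ge fun h => ?_⟩
  have := hmax _ h
  omega

/-- A Dedekind cut: the slope is the supremum of the fractions `m / n` with `m • u ≤ n • g`.
Cofinality makes this set nonempty and bounded. -/
theorem exists_isSlope (hu : 0 < u) (hcof : ∀ g : G, ∃ n : ℕ, g ≤ n • u) (g : G) :
    ∃ t : ℝ, IsSlope u g t := by
  let S : Set ℝ := {x | ∃ (m : ℤ) (n : ℕ), 0 < n ∧ m • u ≤ n • g ∧ x = (m : ℝ) / n}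
  have key : ∀ (m m' : ℤ) (n n' : ℕ), 0 < n → 0 < n' → m • u ≤ n • g → n' • g ≤ m' • u →
      (m : ℝ) / n ≤ m' / n' := by
    intro m m' n n' hn hn' h h'
    rw [div_le_div_iff₀ (by positivity) (by positivity)]
    have h1 : (m * n') • u ≤ (m' * n) • u := by
      calc (m * n') • u = n' • (m • u) := by rw [mul_comm, mul_zsmul, natCast_zsmul]
        _ ≤ n' • (n • g) := nsmul_le_nsmul_right h _
        _ = n • (n' • g) := smul_comm _ _ _
        _ ≤ n • (m' • u) := nsmul_le_nsmul_right h' _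
        _ = (m' * n) • u := by rw [mul_comm, mul_zsmul, natCast_zsmul]
    exact_mod_cast (zsmul_le_zsmul_iff_left hu).1 h1
  obtain ⟨a, ha, ha'⟩ := exists_zsmul_near hu hcof g
  have hne : S.Nonempty := ⟨_, a, 1, one_pos, by simpa using ha, rfl⟩
  have hub : ∀ (m' : ℤ) (n' : ℕ), 0 < n' → n' • g ≤ m' • u → (m' : ℝ) / n' ∈ upperBounds S := by
    rintro m' n' hn' h' _ ⟨m, n, hn, h, rfl⟩
    exact key m m' n n' hn hn' h h'
  have hbdd : BddAbove S := ⟨_, hub (a + 1) 1 one_pos (by simpa using ha'.le)⟩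
  refine ⟨sSup S, fun m n hn => ⟨fun h => ?_, fun h => ?_⟩⟩
  · have : (m : ℝ) / n ≤ sSup S := le_csSup hbdd ⟨m, n, hn, h, rfl⟩
    rwa [div_le_iff₀' (by positivity)] at this
  · have : sSup S ≤ (m : ℝ) / n := csSup_le hne (hub m n hn h)
    rwa [le_div_iff₀' (by positivity)] at this

theorem le_of_forall_nat_mul_le {a b c : ℝ} (h : ∀ N : ℕ, 0 < N → N * a ≤ N * b + c) : a ≤ b := by
  by_contra hab
  push Not at hab
  obtain ⟨N, hN⟩ := exists_nat_gt (c / (a - b))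
  rw [div_lt_iff₀ (sub_pos.2 hab)] at hN
  have := h (N + 1) N.succ_pos
  push_cast at this
  nlinarith

/-- Locating `N • g` between consecutive multiples of `u` puts `N * t` and `N * t'` in the same unit
interval, for every `N > 0`. -/
theorem IsSlope.unique (hu : 0 < u) (hcof : ∀ g : G, ∃ n : ℕ, g ≤ n • u) {g : G} {t t' : ℝ}
    (h : IsSlope u g t) (h' : IsSlope u g t') : t = t' := by
  have aux : ∀ {t t' : ℝ}, IsSlope u g t → IsSlope u g t' → t ≤ t' := by
    intro t t' h h'
    refine le_of_forall_nat_mul_le (c := 1) fun N hN => ?_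
    obtain ⟨a, ha, ha'⟩ := exists_zsmul_near hu hcof (N • g)
    have h1 := (h (a + 1) N hN).2 ha'.le
    have h2 := (h' a N hN).1 ha
    push_cast at h1
    linarith
  exact le_antisymm (aux h h') (aux h' h)

theorem IsSlope.add (hu : 0 < u) (hcof : ∀ g : G, ∃ n : ℕ, g ≤ n • u) {g g' : G} {t t' : ℝ}
    (h : IsSlope u g t) (h' : IsSlope u g' t') : IsSlope u (g + g') (t + t') := by
  intro m n hn
  -- Rounding each summand costs one multiple of `u`, so the total error is 2 independently of `N`
  -- and disappears in the limit.
  have near : ∀ N : ℕ, 0 < N → ∃ a b : ℤ, (a + b) • u ≤ (N * n) • (g + g') ∧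
      (N * n) • (g + g') ≤ (a + b + 2) • u ∧ (a : ℝ) ≤ N * n * t ∧ N * n * t ≤ a + 1 ∧
      (b : ℝ) ≤ N * n * t' ∧ N * n * t' ≤ b + 1 := by
    intro N hN
    obtain ⟨a, ha, ha'⟩ := exists_zsmul_near hu hcof ((N * n) • g)
    obtain ⟨b, hb, hb'⟩ := exists_zsmul_near hu hcof ((N * n) • g')
    refine ⟨a, b, ?_, ?_, ?_, ?_, ?_, ?_⟩
    · rw [add_zsmul, smul_add]; exact add_le_add ha hb
    · rw [show a + b + 2 = (a + 1) + (b + 1) by ring, add_zsmul, smul_add]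
      exact add_le_add ha'.le hb'.le
    · exact_mod_cast (h a (N * n) (by positivity)).1 ha
    · exact_mod_cast (h (a + 1) (N * n) (by positivity)).2 ha'.le
    · exact_mod_cast (h' b (N * n) (by positivity)).1 hb
    · exact_mod_cast (h' (b + 1) (N * n) (by positivity)).2 hb'.le
  refine ⟨fun hm => ?_, fun hm => ?_⟩
  · refine le_of_forall_nat_mul_le (c := 2) fun N hN => ?_
    obtain ⟨a, b, -, h2, h3, h4, h5, h6⟩ := near N hN
    have h7 : ((N : ℤ) * m) • u ≤ (a + b + 2) • u := by
      refine le_trans ?_ h2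
      rw [mul_zsmul, natCast_zsmul, mul_nsmul']
      exact nsmul_le_nsmul_right hm N
    have h8 : (N : ℝ) * m ≤ a + b + 2 := by exact_mod_cast (zsmul_le_zsmul_iff_left hu).1 h7
    linarith
  · refine le_of_forall_nat_mul_le (c := 2) fun N hN => ?_
    obtain ⟨a, b, h1, -, h3, h4, h5, h6⟩ := near N hN
    have h7 : (a + b) • u ≤ ((N : ℤ) * m) • u := by
      refine h1.trans ?_
      rw [mul_zsmul, natCast_zsmul, mul_nsmul']
      exact nsmul_le_nsmul_right hm N
    have h8 : (a : ℝ) + b ≤ N * m := by exact_mod_cast (zsmul_le_zsmul_iff_left hu).1 h7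
    linarith

/-- An ordered abelian group with an element whose multiples are cofinal has a unique monotone
homomorphism to `ℝ` that maps this element to `1`; this is its existence. -/
theorem exists_orderAddMonoidHom_real (hu : 0 < u) (hcof : ∀ g : G, ∃ n : ℕ, g ≤ n • u) :
    ∃ τ : G →+o ℝ, τ u = 1 := by
  choose t ht using exists_isSlope hu hcof
  have hadd : ∀ a b, t (a + b) = t a + t b := fun a b =>
    (ht (a + b)).unique hu hcof ((ht a).add hu hcof (ht b))
  let τ := AddMonoidHom.mk' t hadd
  refine ⟨⟨τ, ?_⟩, ?_⟩
  · intro a b hab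
    have h1 := (ht (b - a) 0 1 one_pos).1 (by simpa using hab)
    have h2 := map_sub τ b a
    change t a ≤ t b
    change t (b - a) = t b - t a at h2
    simp at h1
    linarith
  · change t u = 1
    have h1 := (ht u 1 1 one_pos).1 (by simp)
    have h2 := (ht u 1 1 one_pos).2 (by simp)
    simp at h1 h2
    linarith

/-- A monotone embedding into `ℝ` of a cofinal subgroup extends to a monotone homomorphism. -/
theorem exists_extend_orderAddMonoidHom_real {Γ : Type*} [AddCommGroup Γ] [LinearOrder Γ]
    [IsOrderedAddMonoid Γ] [Nontrivial Γ] {ι : Γ →+o G} (hι : StrictMono ι)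
    {σ : Γ →+o ℝ} (hσ : StrictMono σ) (hcof : ∀ g : G, ∃ γ : Γ, g ≤ ι γ) :
    ∃ τ : G →+o ℝ, ∀ γ, τ (ι γ) = σ γ := by
  obtain ⟨δ, hδ⟩ := exists_zero_lt (α := Γ)
  have hσδ : 0 < σ δ := by simpa using hσ hδ
  have hu : 0 < ι δ := by simpa using hι hδ
  have hcofΓ : ∀ γ : Γ, ∃ n : ℕ, γ ≤ n • δ := fun γ => by
    obtain ⟨n, hn⟩ := Archimedean.arch (σ γ) hσδ
    exact ⟨n, hσ.le_iff_le.1 (by rwa [map_nsmul])⟩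
  have hcof' : ∀ g : G, ∃ n : ℕ, g ≤ n • ι δ := fun g => by
    obtain ⟨γ, hγ⟩ := hcof g
    obtain ⟨n, hn⟩ := hcofΓ γ
    exact ⟨n, hγ.trans (by rw [← map_nsmul]; exact hι.monotone hn)⟩
  obtain ⟨τ, hτ⟩ := exists_orderAddMonoidHom_real hu hcof'
  -- `τ` is normalised to 1 at `ι δ`; rescaling by `σ δ` gives agreement at `δ`, and uniqueness of
  -- slopes in `Γ` gives it everywhere.
  refine ⟨⟨(AddMonoidHom.mulLeft (σ δ)).comp τ, ?_⟩, fun γ => ?_⟩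
  · intro a b hab
    exact mul_le_mul_of_nonneg_left (τ.monotone' hab) hσδ.le
  · change σ δ * τ (ι γ) = σ γ
    have h1 := (τ.comp ι).isSlope (u := δ) (by simp [hτ]) γ
    have h2 := h1.unique hδ hcofΓ (σ.isSlope hσδ γ)
    rw [OrderAddMonoidHom.comp_apply, OrderAddMonoidHom.comp_apply, hτ, div_one] at h2
    rw [h2]
    field_simp

/-- The quotient of `G` by the subgroup `S` has rational rank at most `d`. -/
def RatRankLE (S : AddSubgroup G) (d : ℕ) : Prop :=
  ∀ s : Fin (d + 1) → G, ∃ n : Fin (d + 1) → ℤ, n ≠ 0 ∧ ∑ i, n i • s i ∈ S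

theorem firstFactor_eq_cons {Γ : Type*} [AddCommGroup Γ] [LinearOrder Γ] {d : ℕ} (σ : Γ →+o ℝ)
    (γ : Γ) : firstFactor (d + 1) σ γ = toLex (Fin.cons (σ γ) 0) := by
  apply congrArg toLex
  funext i
  refine Fin.cases ?_ (fun i => ?_) i
  · exact Pi.single_eq_same (M := fun _ : Fin (d + 1) => ℝ) 0 (σ γ)
  · simp

theorem lexReal_cons_pos {d : ℕ} {a : ℝ} {b : LexReal d} (ha : 0 ≤ a) (hb : a = 0 → 0 < b) :
    0 < (toLex (Fin.cons a (ofLex b)) : LexReal (d + 1)) := by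
  rcases ha.lt_or_eq with ha | rfl
  · exact ⟨0, fun j hj => absurd hj (Fin.not_lt_zero j), ha⟩
  · obtain ⟨i, hi, hlt⟩ := hb rfl
    refine ⟨i.succ, fun j hj => ?_, hlt⟩
    exact Fin.cases (fun _ => rfl) (fun j hj => hi j (Fin.succ_lt_succ_iff.1 hj)) j hj

/-- If every ordered group of rational rank at most `d` embeds into `ℝ^(d)`, then an ordered group
whose rational rank over a cofinal subgroup `Γ` of `ℝ` is at most `d` embeds into `ℝ^(d+1)`
compatibly with the embedding of `Γ` into the first factor. -/
theorem exists_extend_lexReal_succ {G : Type u} [AddCommGroup G] [LinearOrder G]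
    [IsOrderedAddMonoid G] {d : ℕ}
    (ih : ∀ (H : Type u) [AddCommGroup H] [LinearOrder H] [IsOrderedAddMonoid H],
      RatRankLE (⊥ : AddSubgroup H) d → ∃ j : H →+o LexReal d, StrictMono j)
    {Γ : Type*} [AddCommGroup Γ] [LinearOrder Γ]
    [IsOrderedAddMonoid Γ] [Nontrivial Γ] {ι : Γ →+o G} (hι : StrictMono ι)
    {σ : Γ →+o ℝ} (hσ : StrictMono σ) (hcof : ∀ g : G, ∃ γ : Γ, g ≤ ι γ)
    (hrank : RatRankLE (ι : Γ →+ G).range d) :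
    ∃ j : G →+o LexReal (d + 1), StrictMono j ∧ ∀ γ, j (ι γ) = firstFactor (d + 1) σ γ := by
  obtain ⟨τ, hτ⟩ := exists_extend_orderAddMonoidHom_real hι hσ hcof
  let H : AddSubgroup G := (τ : G →+ ℝ).ker
  have hker : ∀ γ : Γ, ι γ ∈ H → γ = 0 := fun γ h => by
    have h1 : τ (ι γ) = 0 := h
    rw [hτ] at h1
    exact hσ.injective (h1.trans (map_zero σ).symm)
  -- A nontrivial combination of elements of `H` that lands in the image of `Γ` lies in both
  -- subgroups, hence is zero.
  obtain ⟨i, hi⟩ := ih H (fun s => by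
    obtain ⟨n, hn, γ, hγ⟩ := hrank fun a => s a
    refine ⟨n, hn, ?_⟩
    have h1 : ((∑ a, n a • s a : H) : G) = ι γ := by
      rw [show ι γ = _ from hγ]
      push_cast
      rfl
    have h2 := hker γ (h1 ▸ (∑ a, n a • s a : H).2)
    rw [AddSubgroup.mem_bot]
    apply Subtype.ext
    rw [h1, h2, map_zero]
    rfl)
  let e : H × Γ →+ G := H.subtype.coprod (ι : Γ →+ G)
  have he : Function.Injective e := by
    rw [injective_iff_map_eq_zero]
    rintro ⟨h, γ⟩ h0
    have h1 : (h : G) + ι γ = 0 := h0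
    have h2 : γ = 0 := hker γ (by rw [eq_neg_of_add_eq_zero_right h1]; exact H.neg_mem h.2)
    subst h2
    rw [map_zero, add_zero] at h1
    exact Prod.ext (Subtype.ext h1) rfl
  -- Divisible groups are injective. The map to be extended is `i` on `H` and zero on `Γ`, which
  -- forces `Γ` into the first factor.
  obtain ⟨φ, hφ⟩ := (Module.Baer.of_divisible (Fin d → ℝ)).extension_property_addMonoidHom e he
    ((show H →+ (Fin d → ℝ) from (i : H →+ LexReal d)).comp (AddMonoidHom.fst H Γ))
  have hφH : ∀ h : H, φ h = ofLex (i h) := fun h => by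
    have h1 : φ (h + ι 0) = ofLex (i h) := DFunLike.congr_fun hφ (h, 0)
    rwa [map_zero, add_zero] at h1
  have hφΓ : ∀ γ : Γ, φ (ι γ) = 0 := fun γ => by
    have h1 : φ (0 + ι γ) = ofLex (i 0) := DFunLike.congr_fun hφ (0, γ)
    rwa [map_zero, zero_add] at h1
  let j : G →+ LexReal (d + 1) :=
    AddMonoidHom.mk' (fun g => toLex (Fin.cons (τ g) (φ g))) (fun a b => by
      apply congrArg toLex
      funext x
      refine Fin.cases ?_ (fun x => ?_) x <;> simp)
  have hj : StrictMono j := by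
    intro a b hab
    rw [← sub_pos, ← map_sub]
    have hpos : 0 < b - a := sub_pos.2 hab
    refine lexReal_cons_pos (b := toLex (φ (b - a))) (by simpa using τ.monotone' hpos.le) ?_
    -- If the first coordinate vanishes, then `b - a` lies in `H`, where `φ` is the order embedding
    -- `i`.
    intro h0
    have h1 := hφH ⟨b - a, h0⟩
    change φ (b - a) = _ at h1
    rw [h1, toLex_ofLex]
    have h2 : i 0 < i ⟨b - a, h0⟩ := hi hpos
    rwa [map_zero] at h2
  refine ⟨⟨j, hj.monotone⟩, hj, fun γ => ?_⟩
  rw [firstFactor_eq_cons]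
  change toLex (Fin.cons (τ (ι γ)) (φ (ι γ)) : Fin (d + 1) → ℝ) = _
  rw [hτ, hφΓ]

/-- If no element has cofinal multiples, the rational rank is infinite. Each new element exceeds
every multiple of the bound `b` on the earlier combinations, so its coefficient in a relation must
vanish; it then serves as the next bound. -/
theorem exists_independent_of_not_cofinal (h : ∀ u : G, 0 < u → ∃ g : G, ∀ n : ℕ, n • u < g)
    {u : G} (hu : 0 < u) (N : ℕ) :
    ∃ (s : Fin N → G) (b : G), 0 < b ∧ ∀ n : Fin N → ℤ,
      (∑ i, n i • s i = 0 → n = 0) ∧ ∃ m : ℕ, |∑ i, n i • s i| ≤ m • b := by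
  induction N with
  | zero => exact ⟨Fin.elim0, u, hu, fun n => ⟨fun _ => funext fun i => i.elim0, 0, by simp⟩⟩
  | succ N ih =>
    obtain ⟨s, b, hb, hs⟩ := ih
    obtain ⟨g, hg⟩ := h b hb
    have hg0 : 0 < g := by simpa using hg 0
    refine ⟨Fin.cons g s, g, hg0, fun n => ?_⟩
    obtain ⟨h1, m, hm⟩ := hs (Fin.tail n)
    have hlt := hm.trans_lt (hg m)
    rw [Fin.sum_univ_succ]
    simp only [Fin.cons_zero, Fin.cons_succ]
    change |∑ i : Fin N, n i.succ • s i| < g at hlt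
    change (∑ i : Fin N, n i.succ • s i) = 0 → _ at h1
    set y := ∑ i : Fin N, n i.succ • s i
    refine ⟨fun h0 => ?_, (n 0).natAbs + 1, ?_⟩
    · have hn0 : n 0 = 0 := by
        by_contra hne
        have h2 : |n 0 • g| = |y| := by rw [eq_neg_of_add_eq_zero_left h0, abs_neg]
        rw [abs_zsmul, abs_of_pos hg0] at h2
        have h3 : (1 : ℤ) • g ≤ |n 0| • g :=
          (zsmul_le_zsmul_iff_left hg0).2 (Int.one_le_abs hne)
        rw [one_zsmul, h2] at h3
        exact absurd hlt h3.not_gt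
      rw [hn0, zero_zsmul, zero_add] at h0
      have h4 := h1 h0
      funext i
      refine Fin.cases hn0 (fun i => ?_) i
      exact congrFun h4 i
    · refine (abs_add_le _ _).trans ?_
      rw [add_nsmul, one_nsmul, abs_zsmul, abs_of_pos hg0, Int.abs_eq_natAbs, natCast_zsmul]
      exact add_le_add_right hlt.le _

/-- An ordered abelian group of rational rank at most `d` embeds into `ℝ^(d)`. -/
theorem exists_strictMono_lexReal (d : ℕ) (H : Type u) [AddCommGroup H] [LinearOrder H]
    [IsOrderedAddMonoid H] (hH : RatRankLE (⊥ : AddSubgroup H) d) :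
    ∃ j : H →+o LexReal d, StrictMono j := by
  induction d generalizing H with
  | zero =>
    have : Subsingleton H := by
      refine subsingleton_of_forall_eq 0 fun g => ?_
      obtain ⟨n, hn, h⟩ := hH fun _ => g
      rw [AddSubgroup.mem_bot, Fin.sum_univ_one] at h
      exact (smul_eq_zero.1 h).resolve_left fun h0 =>
        hn (funext fun i => by rw [Fin.fin_one_eq_zero i]; exact h0)
    exact ⟨0, fun a b h => absurd (Subsingleton.elim a b) h.ne⟩
  | succ d ih =>
    by_cases htriv : ∀ g : H, ¬ 0 < g
    · refine ⟨0, fun a b h => absurd (sub_pos.2 h) (htriv _)⟩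
    push Not at htriv
    obtain ⟨g, hg⟩ := htriv
    obtain ⟨u, hu, hcof⟩ : ∃ u : H, 0 < u ∧ ∀ g : H, ∃ n : ℕ, g ≤ n • u := by
      by_contra! hcon
      -- Rational rank at most `d + 1` is tested on families of `d + 2` elements.
      obtain ⟨s, b, -, hs⟩ := exists_independent_of_not_cofinal hcon hg (d + 1 + 1)
      obtain ⟨n, hn, h⟩ := hH s
      exact hn ((hs n).1 h)
    have hmono : StrictMono (zmultiplesHom H u) := fun a b h => (zsmul_lt_zsmul_iff_left hu).2 h
    have hcast : StrictMono (Int.castAddHom ℝ) := fun a b h => Int.cast_lt.2 h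
    obtain ⟨j, hj, -⟩ := exists_extend_lexReal_succ (Γ := ℤ) (G := H)
      (fun H' _ _ _ => ih H') (ι := ⟨zmultiplesHom H u, hmono.monotone⟩) hmono
      (σ := ⟨Int.castAddHom ℝ, hcast.monotone⟩) hcast
      (fun g => by
        obtain ⟨n, hn⟩ := hcof g
        exact ⟨n, hn.trans (natCast_zsmul u n).ge⟩)
      (fun s => by
        -- Adjoining `u` to the family turns a relation in `H` into one modulo `ℤ u`. The part
        -- without `u` is nontrivial because `u` has infinite order.
        obtain ⟨n, hn, h⟩ := hH (Fin.cons u s)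
        rw [AddSubgroup.mem_bot, Fin.sum_univ_succ] at h
        simp only [Fin.cons_zero, Fin.cons_succ] at h
        refine ⟨Fin.tail n, fun h0 => hn ?_, -n 0, ?_⟩
        · have h1 : ∀ i : Fin (d + 1), n i.succ = 0 := fun i => congrFun h0 i
          simp only [h1, zero_zsmul, Finset.sum_const_zero, add_zero] at h
          funext i
          exact Fin.cases ((smul_eq_zero.1 h).resolve_right hu.ne') h1 i
        · rw [eq_neg_of_add_eq_zero_right (b := ∑ i : Fin (d + 1), Fin.tail n i • s i) h,
            ← neg_zsmul]
          rfl)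
    exact ⟨j, hj⟩

end OrderedGroups

/-! ### Dimension, transcendence degree and Abhyankar's inequality. -/

section Abhyankar

/-- The dimension does not drop in an injective integral extension. -/
theorem ringKrullDim_le_of_isIntegral (R S : Type*) [CommRing R] [CommRing S] [Algebra R S]
    [Algebra.IsIntegral R S] (hinj : Function.Injective (algebraMap R S)) :
    ringKrullDim R ≤ ringKrullDim S := by
  refine iSup_le fun l => ?_
  have : FaithfulSMul R S := (faithfulSMul_iff_algebraMap_injective R S).2 hinj
  obtain ⟨P, hP, hPl⟩ := Ideal.nonempty_primesOver (S := S) l.head.asIdeal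
  -- Lying over lifts the smallest prime of the chain; going up lifts the rest without changing the
  -- length.
  obtain ⟨L, hL, -⟩ := Ideal.exists_ltSeries_of_hasGoingUp l P
  rw [← hL]
  exact Order.LTSeries.length_le_krullDim L

/-- The transcendence degree of the fraction field of an affine domain is at most its
dimension. -/
theorem trdeg_le_of_ringKrullDim_le {K D L : Type u} [Field K] [CommRing D] [IsDomain D]
    [Algebra K D] [Algebra.FiniteType K D] [Field L] [Algebra K L] [Algebra D L]
    [IsScalarTower K D L] [IsFractionRing D L] {d : ℕ} (hd : ringKrullDim D ≤ d) :
    Algebra.trdeg K L ≤ d := by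
  -- Noether normalisation: the number `s` of variables bounds the dimension from below and equals
  -- the transcendence degree.
  obtain ⟨s, g, hg, hint⟩ := exists_integral_inj_algHom_of_fg K D
  let _ : Algebra (MvPolynomial (Fin s) K) D := g.toRingHom.toAlgebra
  have : IsScalarTower K (MvPolynomial (Fin s) K) D := IsScalarTower.of_algHom g
  have : Algebra.IsIntegral (MvPolynomial (Fin s) K) D := ⟨hint⟩
  have hinj : Function.Injective (algebraMap (MvPolynomial (Fin s) K) D) := hg
  have : FaithfulSMul (MvPolynomial (Fin s) K) D :=
    (faithfulSMul_iff_algebraMap_injective _ _).2 hinj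
  have h1 := (ringKrullDim_le_of_isIntegral _ _ hinj).trans hd
  rw [MvPolynomial.ringKrullDim_of_isNoetherianRing, ringKrullDim_eq_zero_of_field, zero_add,
    Nat.card_eq_fintype_card, Fintype.card_fin] at h1
  have h2 : s ≤ d := by exact_mod_cast h1
  have : FaithfulSMul K D := (faithfulSMul_iff_algebraMap_injective _ _).2
    (algebraMap K D).injective
  have : FaithfulSMul D L := (faithfulSMul_iff_algebraMap_injective _ _).2
    (IsFractionRing.injective D L)
  have : Algebra.IsAlgebraic D L := IsLocalization.isAlgebraic L (nonZeroDivisors D)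
  rw [← trdeg_add_eq K D (A := L), ← trdeg_add_eq K (MvPolynomial (Fin s) K) (A := D),
    trdeg_eq_zero (R := D), trdeg_eq_zero (A := D), MvPolynomial.trdeg_of_isDomain]
  simpa using h2

variable {K : Type*} [Field K] {Γ : Type*} [AddCommGroup Γ] [LinearOrder Γ]
  [IsOrderedAddMonoid Γ] {G : Type*} [AddCommGroup G] [LinearOrder G] [IsOrderedAddMonoid G]

/-- If the values were pairwise distinct, the unique smallest one would be the value of the sum,
which is `∞`. -/
theorem AddValuation.exists_eq_of_sum_eq_zero {L : Type*} [Field L]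
    (w : AddValuation L (WithTop G)) {α : Type*} {s : Finset α} (hs : s.Nonempty) {t : α → L}
    (ht : ∀ a ∈ s, t a ≠ 0) (h0 : ∑ a ∈ s, t a = 0) :
    ∃ a ∈ s, ∃ b ∈ s, a ≠ b ∧ w (t a) = w (t b) := by
  classical
  by_contra! hcon
  obtain ⟨a, ha, hmin⟩ := s.exists_min_image (fun a => w (t a)) hs
  have h1 : w (t a) < w (∑ b ∈ s \ {a}, t b) := by
    refine w.map_lt_sum (w.ne_top_iff.2 (ht a ha)) fun b hb => ?_
    rw [Finset.mem_sdiff, Finset.mem_singleton] at hb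
    exact lt_of_le_of_ne (hmin b hb.1) (hcon a ha b hb.1 (Ne.symm hb.2))
  have h2 := w.map_add_eq_of_lt_left h1
  rw [← Finset.sum_eq_add_sum_sdiff_singleton_of_mem ha, h0, w.map_zero] at h2
  exact w.ne_top_iff.2 (ht a ha) h2.symm

theorem AddValuation.map_finset_prod {L : Type*} [Field L]
    (w : AddValuation L (WithTop G)) {α : Type*} (s : Finset α) (t : α → L) :
    w (∏ a ∈ s, t a) = ∑ a ∈ s, w (t a) := by
  classical
  induction s using Finset.induction_on with
  | empty => simp
  | insert a s ha ih => rw [Finset.prod_insert ha, Finset.sum_insert ha, w.map_mul, ih]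

/-- **Abhyankar's inequality** for the rational rank: the values of a valuation on a field
extension of transcendence degree less than `m` satisfy a relation over the value group of the base
as soon as there are `m` of them. -/
theorem AddValuation.exists_int_relation {L : Type*} [Field L] [Algebra K L]
    {ν : AddValuation K (WithTop Γ)} {w : AddValuation L (WithTop G)} {ι : Γ →+o G}
    (hw : ∀ c, w (algebraMap K L c) = (ν c).map ι) {m : ℕ} (hm : Algebra.trdeg K L < m)
    (x : Fin m → L) (g : Fin m → G) (hx : ∀ i, w (x i) = g i) :
    ∃ n : Fin m → ℤ, n ≠ 0 ∧ ∑ i, n i • g i ∈ (ι : Γ →+ G).range := by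
  have hnot : ¬ AlgebraicIndependent K x := fun h => by
    have h1 := h.lift_cardinalMk_le_trdeg
    simp only [Cardinal.mk_fin, Cardinal.lift_natCast, Cardinal.lift_id'] at h1
    have h2 : (m : Cardinal) ≤ Algebra.trdeg K L := by simpa using h1
    exact absurd hm h2.not_gt
  rw [algebraicIndependent_iff] at hnot
  push Not at hnot
  obtain ⟨P, hP, hP0⟩ := hnot
  have hx0 : ∀ i, x i ≠ 0 := fun i => w.ne_top_iff.1 (by rw [hx]; exact WithTop.coe_ne_top)
  have hval : ∀ a ∈ P.support, ∃ γ : Γ,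
      w (algebraMap K L (P.coeff a) * ∏ i, x i ^ a i) = ((ι γ + ∑ i, a i • g i : G) : WithTop G) := by
    intro a ha
    have h1 := ν.ne_top_iff.2 (MvPolynomial.mem_support_iff.1 ha)
    obtain ⟨γ, hγ⟩ := WithTop.ne_top_iff_exists.1 h1
    refine ⟨γ, ?_⟩
    rw [w.map_mul, hw, ← hγ, WithTop.map_coe, WithTop.coe_add, w.map_finset_prod,
      WithTop.coe_sum]
    congr 1
    refine Finset.sum_congr rfl fun i _ => ?_
    rw [w.map_pow, hx]
    rfl
  rw [MvPolynomial.aeval_def, MvPolynomial.eval₂_eq'] at hP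
  -- Two distinct monomials of the algebraic relation have equal value; the difference of their
  -- exponents is the integer relation sought.
  obtain ⟨a, ha, b, hb, hab, heq⟩ := w.exists_eq_of_sum_eq_zero
    (MvPolynomial.support_nonempty.2 hP0) (fun a ha => mul_ne_zero
      ((map_ne_zero _).2 (MvPolynomial.mem_support_iff.1 ha))
      (Finset.prod_ne_zero_iff.2 fun i _ => pow_ne_zero _ (hx0 i))) hP
  obtain ⟨γ, hγ⟩ := hval a ha
  obtain ⟨δ, hδ⟩ := hval b hb
  rw [hγ, hδ, WithTop.coe_inj] at heq
  refine ⟨fun i => (a i : ℤ) - b i, fun h => hab (Finsupp.ext fun i => ?_), δ - γ, ?_⟩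
  · have := congrFun h i
    simp only [Pi.zero_apply] at this
    omega
  · simp only [sub_smul, Finset.sum_sub_distrib, natCast_zsmul]
    change ι (δ - γ) = _
    rw [_root_.map_sub, sub_eq_sub_iff_add_eq_add, add_comm _ (ι γ), heq]

end Abhyankar

/-! ### Passage to the residue field, and surjectivity of the comparison map. -/

section Surjectivity

/-- A valuation all of whose values lie in an ordered subgroup `G'` of `G` takes values in `G'`. -/
theorem AddValuation.exists_factor {A G G' : Type*} [CommRing A] [AddCommGroup G] [LinearOrder G]
    [IsOrderedAddMonoid G] [AddCommGroup G'] [LinearOrder G'] [IsOrderedAddMonoid G']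
    {j : G' →+o G} (hj : StrictMono j) (v : AddValuation A (WithTop G))
    (hv : ∀ a, ∃ y : WithTop G', y.map j = v a) :
    ∃ v' : AddValuation A (WithTop G'), ∀ a, (v' a).map j = v a := by
  choose f hf using hv
  have hmono : StrictMono (WithTop.map j) := WithTop.strictMono_map_iff.2 hj
  have hadd : ∀ x y : WithTop G', (x + y).map j = x.map j + y.map j :=
    WithTop.map_add j
  refine ⟨AddValuation.of f (hmono.injective ?_) (hmono.injective ?_) (fun x y => ?_)
    fun x y => hmono.injective ?_, hf⟩
  · rw [hf, v.map_zero]; rfl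
  · rw [hf, v.map_one]; exact congrArg WithTop.some (_root_.map_zero j).symm
  · rw [← hmono.le_iff_le, hmono.monotone.map_min, hf, hf, hf]
    exact v.map_add x y
  · rw [hadd, hf, hf, hf, v.map_mul]

instance AddValuation.supp_isPrime {A G : Type*} [CommRing A] [AddCommGroup G] [LinearOrder G] [IsOrderedAddMonoid G]
    (v : AddValuation A (WithTop G)) : v.supp.IsPrime :=
  have : NoZeroDivisors (Multiplicative (WithTop G)ᵒᵈ) := inferInstance
  have : Nontrivial (Multiplicative (WithTop G)ᵒᵈ) := inferInstance
  inferInstanceAs (Valuation.supp (AddValuation.toValuation v)).IsPrime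

/-- A valuation on `A` induces one on the residue field of its support. -/
theorem AddValuation.exists_fractionRing {A G : Type*} [CommRing A] [AddCommGroup G]
    [LinearOrder G] [IsOrderedAddMonoid G] (v : AddValuation A (WithTop G)) :
    ∃ w : AddValuation (FractionRing (A ⧸ v.supp)) (WithTop G), ∀ a,
      w (algebraMap (A ⧸ v.supp) _ (Ideal.Quotient.mk _ a)) = v a := by
  let v' : Valuation (A ⧸ v.supp) (Multiplicative (WithTop G)ᵒᵈ) := Valuation.onQuot v le_rfl
  have hS : nonZeroDivisors (A ⧸ v.supp) ≤ v'.supp.primeCompl := fun x hx h0 => by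
    rw [show v'.supp = 0 from Valuation.supp_quot_supp v] at h0
    exact nonZeroDivisors.ne_zero hx h0
  exact ⟨AddValuation.ofValuation (v'.extendToLocalization hS _), fun a =>
    v'.extendToLocalization_apply_map_apply hS _ (Ideal.Quotient.mk _ a)⟩

variable {K A : Type u} [Field K] [CommRing A] {Γ : Type w} [AddCommGroup Γ] [LinearOrder Γ]
  [IsOrderedAddMonoid Γ] [Nontrivial Γ] {ν : AddValuation K (WithTop Γ)}

theorem AdicValuation.exists_hahnPoint (hν : ∀ γ : Γ, ∃ z : K, ν z = γ) {σ : Γ →+o ℝ}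
    (hσ : StrictMono σ) {φ : K →+* A} (hφ : φ.FiniteType) {d : ℕ} (hd : ringKrullDim A ≤ d)
    (v : AdicValuation ν φ) :
    ∃ x : HahnPoint ν (firstFactor (d + 1) σ) φ,
      (Quot.mk _ (x.toAdic hν (firstFactor_strictMono hσ) (firstFactor_cofinal hσ)) :
        AffineAdicSpace ν φ) = Quot.mk _ v := by
  let _ : Algebra K A := φ.toAlgebra
  have : Algebra.FiniteType K A := hφ
  obtain ⟨w, hw⟩ := v.val.exists_fractionRing
  set D := A ⧸ v.val.supp with hD
  set L := FractionRing D with hL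
  have : Algebra.FiniteType K D :=
    Algebra.FiniteType.of_surjective (Ideal.Quotient.mkₐ K v.val.supp)
      Ideal.Quotient.mk_surjective
  have htr : Algebra.trdeg K L ≤ d :=
    trdeg_le_of_ringKrullDim_le (D := D) ((ringKrullDim_quotient_le _).trans hd)
  have hwK : ∀ c, w (algebraMap K L c) = (ν c).map v.ι := fun c => by
    rw [← v.val_map, ← hw, IsScalarTower.algebraMap_apply K D L]
    rfl
  -- The given `Υ` may be larger than the value group of `w`, so neither cofinality of `Γ` nor the
  -- rank bound need hold there; both hold in `Υ'`.
  let Υ' : AddSubgroup v.Υ :=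
    { carrier := {g | ∃ x : L, w x = g}
      zero_mem' := ⟨1, w.map_one⟩
      add_mem' := by
        rintro a b ⟨x, hx⟩ ⟨y, hy⟩
        exact ⟨x * y, by rw [w.map_mul, hx, hy, WithTop.coe_add]⟩
      neg_mem' := by
        rintro a ⟨x, hx⟩
        exact ⟨x⁻¹, by rw [w.map_inv, hx]; rfl⟩ }
  have hιmem : ∀ γ : Γ, v.ι γ ∈ Υ' := fun γ => by
    obtain ⟨z, hz⟩ := hν γ
    exact ⟨algebraMap K L z, by rw [hwK, hz]; rfl⟩
  let incl : Υ' →+o v.Υ := ⟨Υ'.subtype, fun _ _ h => h⟩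
  have hincl : StrictMono incl := fun _ _ h => h
  let ι' : Γ →+o Υ' :=
    ⟨(v.ι : Γ →+ v.Υ).codRestrict Υ' hιmem, fun _ _ h => v.ι.monotone' h⟩
  have hι' : StrictMono ι' := fun _ _ h => v.ι_strictMono h
  -- Write `g` as `v(a) - v(b)`: continuity bounds `v(a)` from above and boundedness bounds `v(b)`
  -- from below, both by values of `K`.
  have hcof : ∀ g : Υ', ∃ γ : Γ, g ≤ ι' γ := by
    rintro ⟨g, x, hx⟩
    obtain ⟨a, b, hb, rfl⟩ := IsFractionRing.div_surjective (A := D) x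
    obtain ⟨a, rfl⟩ := Ideal.Quotient.mk_surjective a
    obtain ⟨b, rfl⟩ := Ideal.Quotient.mk_surjective b
    have hb0 : algebraMap D L (Ideal.Quotient.mk _ b) ≠ 0 :=
      IsFractionRing.to_map_ne_zero_of_mem_nonZeroDivisors hb
    have hmul : (g : WithTop v.Υ) + v.val b = v.val a := by
      rw [← hx, ← hw b, ← hw a, ← w.map_mul, div_mul_cancel₀ _ hb0]
    have hbt : v.val b ≠ ⊤ := by rw [← hw b]; exact w.ne_top_iff.2 hb0
    obtain ⟨q, hq⟩ := WithTop.ne_top_iff_exists.1 hbt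
    have hat : v.val a ≠ ⊤ := by
      rw [← hmul, ← hq, ← WithTop.coe_add]; exact WithTop.coe_ne_top
    obtain ⟨c, hc, hac⟩ := v.continuous a hat
    obtain ⟨c', hc', hbc'⟩ := v.bounded b
    obtain ⟨γ, hγ⟩ := WithTop.ne_top_iff_exists.1 (ν.ne_top_iff.2 hc)
    obtain ⟨γ', hγ'⟩ := WithTop.ne_top_iff_exists.1 (ν.ne_top_iff.2 hc')
    rw [v.val_map, ← hγ, WithTop.map_coe, ← hmul, ← hq, ← WithTop.coe_add,
      WithTop.coe_lt_coe] at hac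
    rw [v.val_map, ← hγ', WithTop.map_coe, ← hq, WithTop.coe_le_coe] at hbc'
    refine ⟨γ - γ', ?_⟩
    change g ≤ v.ι (γ - γ')
    rw [map_sub, le_sub_iff_add_le]
    exact (add_le_add_right hbc' g).trans hac.le
  have hrank : RatRankLE (ι' : Γ →+ Υ').range d := fun s => by
    choose x hx using fun i => (s i).2
    obtain ⟨n, hn, γ, hγ⟩ := AddValuation.exists_int_relation (m := d + 1) hwK
      (htr.trans_lt (by exact_mod_cast d.lt_succ_self)) x (fun i => s i) hx
    refine ⟨n, hn, γ, Subtype.ext ?_⟩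
    push_cast
    exact hγ
  obtain ⟨j, hj, hjι⟩ := exists_extend_lexReal_succ (fun H _ _ _ => exists_strictMono_lexReal d H)
    hι' hσ hcof hrank
  obtain ⟨v', hv'⟩ := AddValuation.exists_factor hincl v.val fun a => by
    induction ha : v.val a using WithTop.recTopCoe with
    | top => exact ⟨⊤, rfl⟩
    | coe g => exact ⟨((⟨g, _, (hw a).trans ha⟩ : Υ') : WithTop Υ'), rfl⟩
  have hv'K : ∀ z, v' (φ z) = (ν z).map ι' := fun z => by
    apply (WithTop.strictMono_map_iff.2 hincl).injective
    rw [hv', v.val_map, WithTop.map_map]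
    rfl
  -- `v` with its values restricted to `Υ'`; it maps both to `v` and to the Hahn point, which links
  -- their classes.
  let y : AdicValuation ν φ :=
    { Υ := Υ'
      val := v'
      ι := ι'
      ι_strictMono := hι'
      val_map := hv'K
      bounded := fun f => by
        obtain ⟨c, hc, h⟩ := v.bounded f
        refine ⟨c, hc, (WithTop.strictMono_map_iff.2 hincl).le_iff_le.1 ?_⟩
        rwa [hv', hv']
      continuous := fun f hf => by
        have hf' : v.val f ≠ ⊤ := by
          rw [← hv']
          exact fun h => hf (WithTop.map_eq_top_iff.1 h)
        obtain ⟨c, hc, h⟩ := v.continuous f hf'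
        refine ⟨c, hc, (WithTop.strictMono_map_iff.2 hincl).lt_iff_lt.1 ?_⟩
        rwa [hv', hv'] }
  let x : HahnPoint ν (firstFactor (d + 1) σ) φ :=
    { val := v'.map ((j : Υ' →+ LexReal (d + 1)).withTopMap) rfl
        (WithTop.monotone_map_iff.2 hj.monotone)
      val_map := fun z => by
        change WithTop.map j (v' (φ z)) = _
        rw [hv'K, WithTop.map_map]
        congr 1
        funext γ
        exact hjι γ }
  refine ⟨x, ?_⟩
  have h1 : AdicValuation.Rel y v := ⟨incl, hincl, fun a => (hv' a).symm⟩
  have h2 : AdicValuation.Rel y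
      (x.toAdic hν (firstFactor_strictMono hσ) (firstFactor_cofinal hσ)) :=
    ⟨(lexRealULift.{u} (d + 1)).comp j, (lexRealULift_strictMono (d + 1)).comp hj, fun a => by
      change WithTop.map (lexRealULift.{u} (d + 1)) (WithTop.map j (v' a)) = _
      rw [WithTop.map_map]
      rfl⟩
  exact (Quot.sound h2).symm.trans (Quot.sound h1)

/-- The spectrum of the ring of functions carries the subspace topology of `U`, and dimension is
monotone along inducing maps. -/
theorem ringKrullDim_le_topologicalKrullDim {X : Scheme.{u}} {U : X.Opens}
    (hU : IsAffineOpen U) : ringKrullDim Γ(X, U) ≤ topologicalKrullDim X := by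
  rw [← PrimeSpectrum.topologicalKrullDim_eq_ringKrullDim]
  exact hU.fromSpec.isOpenEmbedding.isInducing.topologicalKrullDim_le

theorem structureHom_finiteType {X : Scheme.{u}} (f : X ⟶ Spec (.of K)) [LocallyOfFiniteType f]
    {U : X.Opens} (hU : IsAffineOpen U) : (structureHom f U).FiniteType := by
  rw [structureHom, CommRingCat.hom_comp]
  refine (f.finiteType_appLE (isAffineOpen_top _) hU _).comp ?_
  exact RingHom.FiniteType.of_surjective _
    (Scheme.ΓSpecIso (.of K)).symm.commRingCatIsoToRingEquiv.surjective

end Surjectivity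

theorem mainTheorem6 {K : Type u} [Field K] {Γ : Type w} [AddCommGroup Γ] [LinearOrder Γ]
    [IsOrderedAddMonoid Γ] [Nontrivial Γ] (ν : AddValuation K (WithTop Γ))
    (hν : ∀ γ : Γ, ∃ z : K, ν z = γ) (hK : IsCompleteValuedField ν)
    (σ : Γ →+o ℝ) (hσ : StrictMono σ)
    {X : Scheme.{u}} (f : X ⟶ Spec (.of K)) [IsSeparated f] [LocallyOfFiniteType f]
    [QuasiCompact f] (k : ℕ) [NeZero k] (hk : 1 + topologicalKrullDim X ≤ (k : WithBot ℕ∞)) :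
    Function.Surjective
      (huberComparison hν (firstFactor_strictMono (k := k) hσ) (firstFactor_cofinal hσ) f) := by
  rintro ⟨⟨U, ⟨v⟩⟩⟩
  -- One coordinate is reserved for `σ`; the other `d` absorb the rational rank over `Γ`.
  obtain ⟨d, rfl⟩ := Nat.exists_eq_succ_of_ne_zero (NeZero.ne k)
  have hd : ringKrullDim Γ(X, U.1) ≤ d := by
    have h1 := (add_le_add_right (ringKrullDim_le_topologicalKrullDim U.2) 1).trans hk
    rw [Nat.succ_eq_add_one, Nat.cast_add, Nat.cast_one, add_comm (d : WithBot ℕ∞)] at h1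
    exact ENat.WithBot.add_le_add_one_left_iff.1 h1
  obtain ⟨x, hx⟩ := v.exists_hahnPoint hν hσ (structureHom_finiteType f U.2) hd
  exact ⟨Quot.mk _ ⟨U, x⟩, congrArg (fun y => Quot.mk (AdicGlue ν f) ⟨U, y⟩) hx⟩
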